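/- A \emph{simple signed graph} $G$ is a finite simple graph together with a sign $\sigma(e)\in\{+1,-1\}$ for each edge $e$. It is \emph{balanced} if the product of the signs of the edges on every circuit (simple closed path) of $G$ is $+1$, and \emph{unbalanced} otherwise. A \emph{proper colouring} of $G$ is a map $\phi\colon V(G)\to\mathbb{Z}$ such that $\phi(u)\ne\sigma(e)\phi(v)$ for every edge $e=uv$. For $n\ge 1$ let $M_n=\{\pm1,\pm2,\dots,\pm k\}$ if $n=2k$, and $M_n=\{0,\pm1,\pm2,\dots,\pm k\}$ if $n=2k+1$. The \emph{chromatic number} $\chi(G)$ of $G$ is the smallest $n\ge 1$ such that $G$ has a proper colouring with all colours in $M_n$. Let $\Delta(G)$ denote the maximum degree of $G$. \textbf{Theorem (Brooks theorem for signed graphs).} Let $G$ be a (non-empty) connected simple signed graph. If $G$ is not a balanced complete graph, a balanced circuit of odd length, or an unbalanced circuit of even length, then $\chi(G)\le\Delta(G)$. -/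

import Mathlib

/-- A simple signed graph on the vertex set `V`: a simple graph together with a sign
`+1` or `-1` on each edge. -/
structure SignedGraph (V : Type*) where
  /-- the underlying unsigned graph -/
  graph : SimpleGraph V
  /-- the sign of each edge -/
  sign : graph.edgeSet → ℤˣ

namespace SignedGraph

/-- The set of colours `M_n`: it is `{±1, …, ±k}` for `n = 2k` and `{0, ±1, …, ±k}` for
`n = 2k + 1` (see `colourSet_even` and `colourSet_odd`). -/
def colourSet (n : ℕ) : Set ℤ :=
  {c | c.natAbs ≤ n / 2 ∧ (c = 0 → Odd n)}

theorem colourSet_even (k : ℕ) :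
    colourSet (2 * k) = {c : ℤ | ∃ i : ℕ, 1 ≤ i ∧ i ≤ k ∧ (c = i ∨ c = -i)} := by
  ext c
  simp only [colourSet, Set.mem_ofPred_eq, Nat.odd_iff]
  constructor
  · rintro ⟨h, h0⟩
    exact ⟨c.natAbs, by omega, by omega, by omega⟩
  · rintro ⟨i, h1, h2, h3⟩
    omega

theorem colourSet_odd (k : ℕ) :
    colourSet (2 * k + 1) = {c : ℤ | c = 0 ∨ ∃ i : ℕ, 1 ≤ i ∧ i ≤ k ∧ (c = i ∨ c = -i)} := by
  ext c
  simp only [colourSet, Set.mem_ofPred_eq, Nat.odd_iff]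
  constructor
  · rintro ⟨h, -⟩
    by_cases hc : c = 0
    · exact Or.inl hc
    · exact Or.inr ⟨c.natAbs, by omega, by omega, by omega⟩
  · rintro (h | ⟨i, h1, h2, h3⟩) <;> omega

variable {V : Type*}

/-- A proper colouring: `φ u ≠ σ(e) φ v` for every edge `e = uv`. -/
def IsProperColouring (G : SignedGraph V) (φ : V → ℤ) : Prop :=
  ∀ (u v : V) (h : G.graph.Adj u v), φ u ≠ (G.sign ⟨s(u, v), h⟩ : ℤ) * φ v

/-- `G` admits an `n`-colouring, that is, a proper colouring with colours from `M_n`. -/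
def IsColourable (G : SignedGraph V) (n : ℕ) : Prop :=
  ∃ φ : V → ℤ, G.IsProperColouring φ ∧ ∀ v, φ v ∈ colourSet n

/-- The chromatic number: the smallest `n ≥ 1` such that `G` admits an `n`-colouring
(and `⊤` if there is none). -/
noncomputable def chromaticNumber (G : SignedGraph V) : ℕ∞ :=
  ⨅ n ∈ {n : ℕ | 1 ≤ n ∧ G.IsColourable n}, (n : ℕ∞)

/-- The product of the signs of the edges that a walk traverses. -/
def walkSign (G : SignedGraph V) {u v : V} (p : G.graph.Walk u v) : ℤˣ :=
  (p.darts.map fun d => G.sign ⟨d.edge, d.edge_mem⟩).prod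

/-- A signed graph is balanced if the sign product on each simple circuit is positive. -/
def IsBalanced (G : SignedGraph V) : Prop :=
  ∀ (v : V) (c : G.graph.Walk v v), c.IsCycle → G.walkSign c = 1

/-- The underlying graph is complete. -/
def IsComplete (G : SignedGraph V) : Prop :=
  G.graph = ⊤

/-- The underlying graph is a circuit of length `n`. -/
def IsCircuit (G : SignedGraph V) (n : ℕ) : Prop :=
  3 ≤ n ∧ Nonempty (G.graph ≃g SimpleGraph.cycleGraph n)

/-- The underlying graph is a circuit of odd length. -/
def IsOddCircuit (G : SignedGraph V) : Prop :=
  ∃ n, Odd n ∧ G.IsCircuit n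

/-- The underlying graph is a circuit of even length. -/
def IsEvenCircuit (G : SignedGraph V) : Prop :=
  ∃ n, Even n ∧ G.IsCircuit n

end SignedGraph

/-! Let `k` be the maximum degree. `M_k` has `k` elements and is closed under negation, and a
coloured neighbour `w` of `v` forbids exactly one colour at `v`, namely `σ(vw) φ(w)`. Greedy
colouring therefore succeeds at `v` if `v` has degree below `k`, has an uncoloured neighbour, or has
two coloured neighbours that forbid the same colour (`IsProperOn.exists_extension`). A connected
graph with a vertex of degree below `k` is coloured towards that vertex. Otherwise a coincidence of
forbidden colours has to be produced at the last vertex.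

In an unbalanced complete graph some triangle `u, x, y` is unbalanced, and `x`, `y` can both forbid
`1` at `u`. In a regular graph that is not complete, a path with non-adjacent `p 0`, `p 2` is
extended until all neighbours of its end `p n` lie on it; with `p j` the earliest of them, `p j, …,
p n` is a circuit. If it misses a vertex, its complement is coloured first, and a circuit vertex
without outside neighbours is free to duplicate a prohibition at its predecessor
(`isColourable_of_circuit_ne_univ`). If it spans and `k ≥ 3`, then `p 0` and `p 2` forbid the same
colour at `p 1` (`isColourable_of_hamiltonian_path`). If `k = 2`, the graph is a circuit, and
colours `±1` suffice outside the excluded cases (`isColourable_two_of_circuit`). -/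

namespace SignedGraph

variable {V : Type*} (G : SignedGraph V)

/-! ### Edge signs, potentials and balance -/

section Sign

variable [DecidableRel G.graph.Adj]

/-- The sign of the pair `u, v`, extended by `1` to non-adjacent pairs. -/
def pairSign (u v : V) : ℤˣ :=
  if h : G.graph.Adj u v then G.sign ⟨s(u, v), h⟩ else 1

variable {G}

theorem pairSign_of_adj {u v : V} (h : G.graph.Adj u v) :
    G.pairSign u v = G.sign ⟨s(u, v), h⟩ := by
  simp [pairSign, h]

variable (G) in
theorem pairSign_comm (u v : V) : G.pairSign u v = G.pairSign v u := by
  by_cases h : G.graph.Adj u v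
  · rw [pairSign_of_adj h, pairSign_of_adj h.symm]
    congr 2
    exact Sym2.eq_swap
  · have h' : ¬ G.graph.Adj v u := fun h' => h h'.symm
    simp [pairSign, h, h']

/-- A sign function on the vertices that induces the signs of the edges. -/
def IsPotential (G : SignedGraph V) [DecidableRel G.graph.Adj] (θ : V → ℤˣ) : Prop :=
  ∀ u v, G.graph.Adj u v → G.pairSign u v = θ u * θ v

theorem walkSign_cons {u v w : V} (h : G.graph.Adj u v) (p : G.graph.Walk v w) :
    G.walkSign (.cons h p) = G.pairSign u v * G.walkSign p := by
  rw [pairSign_of_adj h]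
  simp [walkSign, SimpleGraph.Dart.edge]

/-- The product telescopes: each interior visit contributes the square of a sign. -/
theorem IsPotential.walkSign_eq {θ : V → ℤˣ} (hθ : G.IsPotential θ) {u v : V}
    (p : G.graph.Walk u v) : G.walkSign p = θ u * θ v := by
  induction p with
  | nil => simp [walkSign, Int.units_mul_self]
  | cons h p ih =>
    rw [walkSign_cons, ih, hθ _ _ h, mul_assoc, ← mul_assoc (θ _) (θ _) (θ _),
      Int.units_mul_self, one_mul]

theorem IsPotential.isBalanced {θ : V → ℤˣ} (hθ : G.IsPotential θ) : G.IsBalanced := by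
  intro v c _
  rw [hθ.walkSign_eq, Int.units_mul_self]

end Sign

/-! ### Greedy colouring -/

theorem exists_adj_dist_lt {Γ : SimpleGraph V} (hconn : Γ.Connected) {v r : V} (h : v ≠ r) :
    ∃ w, Γ.Adj v w ∧ Γ.dist w r < Γ.dist v r := by
  obtain ⟨p, hp⟩ := hconn.exists_walk_length_eq_dist v r
  cases p with
  | nil => exact absurd rfl h
  | cons hvw q =>
    refine ⟨_, hvw, ?_⟩
    have := SimpleGraph.dist_le q
    rw [SimpleGraph.Walk.length_cons] at hp
    omega

theorem exists_finset_colourSet (k : ℕ) :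
    ∃ M : Finset ℤ, M.card = k ∧ ∀ c, c ∈ M ↔ c ∈ colourSet k := by
  obtain ⟨m, rfl | rfl⟩ := k.even_or_odd'
  · refine ⟨(Finset.Icc (-(m : ℤ)) m).erase 0, ?_, fun c => ?_⟩
    · rw [Finset.card_erase_of_mem (by simp), Int.card_Icc]
      omega
    · simp only [Finset.mem_erase, Finset.mem_Icc, colourSet, Set.mem_ofPred_eq, Nat.odd_iff]
      omega
  · refine ⟨Finset.Icc (-(m : ℤ)) m, ?_, fun c => ?_⟩
    · rw [Int.card_Icc]
      omega
    · simp only [Finset.mem_Icc, colourSet, Set.mem_ofPred_eq, Nat.odd_iff]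
      omega

theorem unit_mul_mem_colourSet {k : ℕ} {c : ℤ} (s : ℤˣ) (hc : c ∈ colourSet k) :
    (s : ℤ) * c ∈ colourSet k := by
  obtain rfl | rfl := Int.units_eq_one_or s <;> simpa [colourSet] using hc

theorem unit_mem_colourSet {k : ℕ} (hk : 2 ≤ k) (s : ℤˣ) : (s : ℤ) ∈ colourSet k := by
  have h : 1 ≤ k / 2 := by omega
  obtain rfl | rfl := Int.units_eq_one_or s <;> simpa [colourSet] using h

theorem unit_mul_unit_mul (s : ℤˣ) (c : ℤ) : (s : ℤ) * (s * c) = c := by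
  obtain rfl | rfl := Int.units_eq_one_or s <;> simp

variable [DecidableRel G.graph.Adj]

/-- `φ` is proper on the subgraph induced by `S`, with colours from `M_k`. -/
def IsProperOn (k : ℕ) (φ : V → ℤ) (S : Set V) : Prop :=
  (∀ u ∈ S, ∀ v ∈ S, G.graph.Adj u v → φ u ≠ G.pairSign u v * φ v) ∧ ∀ v ∈ S, φ v ∈ colourSet k

variable {G}

theorem IsProperOn.isColourable {k : ℕ} {φ : V → ℤ} (h : G.IsProperOn k φ Set.univ) :
    G.IsColourable k := by
  refine ⟨φ, fun u v huv => ?_, fun v => h.2 v trivial⟩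
  rw [← pairSign_of_adj huv]
  exact h.1 u trivial v trivial huv

theorem IsProperOn.congr {k : ℕ} {φ ψ : V → ℤ} {S : Set V} (h : G.IsProperOn k φ S)
    (hψ : ∀ v ∈ S, ψ v = φ v) : G.IsProperOn k ψ S := by
  refine ⟨fun u hu v hv => ?_, fun v hv => ?_⟩
  · rw [hψ u hu, hψ v hv]
    exact h.1 u hu v hv
  · rw [hψ v hv]
    exact h.2 v hv

theorem IsProperOn.insert_of_ne {k : ℕ} {φ : V → ℤ} {S : Set V} {x : V} (h : G.IsProperOn k φ S)
    (hx : φ x ∈ colourSet k) (hxS : ∀ v ∈ S, G.graph.Adj x v → φ x ≠ G.pairSign x v * φ v) :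
    G.IsProperOn k φ (insert x S) := by
  refine ⟨?_, ?_⟩
  · rintro u (rfl | hu) v (rfl | hv) huv
    · exact absurd huv (G.graph.irrefl)
    · exact hxS v hv huv
    · intro he
      apply hxS u hu huv.symm
      rw [he, pairSign_comm, unit_mul_unit_mul]
    · exact h.1 u hu v hv huv
  · rintro v (rfl | hv)
    · exact hx
    · exact h.2 v hv

variable [Fintype V] [DecidableEq V]

/-- A partial colouring extends greedily in order of decreasing rank `f`, if each further vertex
has small degree, an uncoloured neighbour of smaller rank or outside the region, or
two coloured neighbours that forbid the same colour. -/
theorem IsProperOn.exists_extension {k : ℕ} (hdeg : ∀ v, G.graph.degree v ≤ k) (f : V → ℕ)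
    {R S : Finset V} {φ : V → ℤ} (hSR : Disjoint S R) (hφ : G.IsProperOn k φ S)
    (hR : ∀ v ∈ R, G.graph.degree v < k ∨ (∃ w, G.graph.Adj v w ∧ w ∉ S ∧ w ∉ R) ∨
      (∃ u ∈ S, ∃ w ∈ S, u ≠ w ∧ G.graph.Adj v u ∧ G.graph.Adj v w ∧
        (G.pairSign v u : ℤ) * φ u = G.pairSign v w * φ w) ∨
      ∃ w ∈ R, G.graph.Adj v w ∧ f w < f v) :
    ∃ ψ : V → ℤ, (∀ v ∈ S, ψ v = φ v) ∧ G.IsProperOn k ψ (S ∪ R : Finset V) := by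
  induction hn : R.card generalizing R S φ with
  | zero =>
    obtain rfl := Finset.card_eq_zero.1 hn
    exact ⟨φ, fun _ _ => rfl, by simpa using hφ⟩
  | succ n ih =>
    -- Since `x` has maximal rank, it is never the lower-ranked neighbour that another vertex of `R`
    -- relies on.
    obtain ⟨x, hxR, hmax⟩ := R.exists_max_image f (Finset.card_pos.1 (by omega))
    have hxS : x ∉ S := fun h => Finset.disjoint_left.1 hSR h hxR
    set N := {v ∈ S | G.graph.Adj x v} with hN
    set F := N.image (fun v => (G.pairSign x v : ℤ) * φ v) with hF
    have hNsub : N ⊆ G.graph.neighborFinset x := fun v hv => by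
      simpa using (Finset.mem_filter.1 hv).2
    have hNle : N.card ≤ G.graph.degree x := Finset.card_le_card hNsub
    have hout : (∃ w, G.graph.Adj x w ∧ w ∉ S) → F.card < k := by
      rintro ⟨w, hw, hwS⟩
      refine lt_of_le_of_lt Finset.card_image_le (lt_of_lt_of_le ?_ (hdeg x))
      refine Finset.card_lt_card ⟨hNsub, fun h => hwS ?_⟩
      exact (Finset.mem_filter.1 (h ((G.graph.mem_neighborFinset x w).2 hw))).1
    have hFk : F.card < k := by
      obtain h | ⟨w, hw, hwS, -⟩ | ⟨u, hu, w, hw, huw, hxu, hxw, he⟩ | ⟨w, hw, hxw, -⟩ := hR x hxR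
      · exact lt_of_le_of_lt (Finset.card_image_le.trans hNle) h
      · exact hout ⟨w, hw, hwS⟩
      -- Two neighbours share a forbidden colour, so there are fewer forbidden colours than coloured
      -- neighbours.
      · have hinj : ¬ Set.InjOn (fun v => (G.pairSign x v : ℤ) * φ v) N := fun h =>
          huw (h (by simp [hN, hu, hxu]) (by simp [hN, hw, hxw]) he)
        have hne : F.card ≠ N.card := fun h => hinj (Finset.card_image_iff.1 h)
        have : F.card ≤ N.card := Finset.card_image_le
        have := hdeg x
        omega
      · exact hout ⟨w, hxw, fun h => Finset.disjoint_left.1 hSR h hw⟩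
    obtain ⟨M, hMk, hM⟩ := exists_finset_colourSet k
    obtain ⟨c, hcM, hcF⟩ := Finset.exists_mem_notMem_of_card_lt_card (hFk.trans_eq hMk.symm)
    set φ' := Function.update φ x c with hφ'
    have hagree : ∀ v ∈ S, φ' v = φ v := fun v hv => by
      rw [hφ', Function.update_of_ne (ne_of_mem_of_not_mem hv hxS)]
    have hprop : G.IsProperOn k φ' (insert x S : Finset V) := by
      rw [Finset.coe_insert]
      refine (hφ.congr hagree).insert_of_ne (by simpa [hφ'] using (hM c).1 hcM) fun v hv hxv he => ?_
      rw [hagree v hv, hφ', Function.update_self] at he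
      exact hcF (Finset.mem_image.2 ⟨v, Finset.mem_filter.2 ⟨hv, hxv⟩, he.symm⟩)
    obtain ⟨ψ, hψ, hψp⟩ := ih (R := R.erase x) (S := insert x S) (φ := φ') (by
        rw [Finset.disjoint_insert_left]
        exact ⟨by simp, hSR.mono_right (Finset.erase_subset _ _)⟩) hprop (by
        intro v hv
        obtain ⟨hvx, hvR⟩ := Finset.mem_erase.1 hv
        obtain h | ⟨w, hw, hwS, hwR⟩ | ⟨u, hu, w, hw, huw, hxu, hxw, he⟩ | ⟨w, hw, hxw, hf⟩ :=
          hR v hvR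
        · exact .inl h
        · refine .inr (.inl ⟨w, hw, ?_, fun h => hwR (Finset.mem_of_mem_erase h)⟩)
          rw [Finset.mem_insert, not_or]
          exact ⟨fun h => hwR (h ▸ hxR), hwS⟩
        · refine .inr (.inr (.inl ⟨u, by simp [hu], w, by simp [hw], huw, hxu, hxw, ?_⟩))
          rw [hagree u hu, hagree w hw, he]
        · refine .inr (.inr (.inr ⟨w, Finset.mem_erase.2 ⟨?_, hw⟩, hxw, hf⟩))
          rintro rfl
          exact absurd (hmax v hvR) (by omega)) (by
        rw [Finset.card_erase_of_mem hxR, hn]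
        rfl)
    refine ⟨ψ, fun v hv => (hψ v (by simp [hv])).trans (hagree v hv), ?_⟩
    convert hψp using 2
    rw [Finset.insert_union, ← Finset.union_insert, Finset.insert_erase hxR]

/-- If the neighbours `x`, `y` of `u` can be coloured so that they forbid the same colour at `u`
and every other vertex is led to `u` by a rank function, then `G` is colourable. -/
theorem isColourable_of_pair {k : ℕ} (hk : 2 ≤ k) (hdeg : ∀ v, G.graph.degree v ≤ k) {u x y : V}
    (hxy : x ≠ y) (hux : G.graph.Adj u x) (huy : G.graph.Adj u y)
    (hs : G.graph.Adj x y → G.pairSign u x ≠ G.pairSign x y * G.pairSign u y) (f : V → ℕ)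
    (hf : ∀ v, v ≠ x → v ≠ y → v ≠ u → ∃ w, w ≠ x ∧ w ≠ y ∧ G.graph.Adj v w ∧ f w < f v) :
    G.IsColourable k := by
  -- With this choice `x` and `y` both forbid the colour `1` at `u`; `hs` says that the choice is
  -- proper on a possible edge `xy`.
  set φ : V → ℤ := fun v => G.pairSign u v with hφ
  have hprop : G.IsProperOn k φ ({x, y} : Finset V) := by
    rw [Finset.coe_insert, Finset.coe_singleton]
    refine IsProperOn.insert_of_ne ⟨?_, ?_⟩ (unit_mem_colourSet hk _) ?_
    · rintro a rfl b rfl hab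
      exact absurd hab (G.graph.irrefl)
    · rintro a rfl
      exact unit_mem_colourSet hk _
    · rintro v rfl hxv he
      exact hs hxv (Units.ext (by simpa [hφ] using he))
  obtain ⟨ψ, -, hψ⟩ := hprop.exists_extension hdeg f (R := ({x, y} : Finset V)ᶜ)
    disjoint_compl_right (by
      intro v hv
      simp only [Finset.mem_compl, Finset.mem_insert, Finset.mem_singleton, not_or] at hv
      by_cases hvu : v = u
      · subst hvu
        refine .inr (.inr (.inl ⟨x, by simp, y, by simp, hxy, hux, huy, ?_⟩))
        simp only [hφ, ← Units.val_mul, Int.units_mul_self]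
      · obtain ⟨w, hwx, hwy, hvw, hfw⟩ := hf v hv.1 hv.2 hvu
        exact .inr (.inr (.inr ⟨w, by simp [hwx, hwy], hvw, hfw⟩)))
  rw [Finset.union_compl, Finset.coe_univ] at hψ
  exact hψ.isColourable

theorem isColourable_of_degree_lt {k : ℕ} (hconn : G.graph.Connected)
    (hdeg : ∀ v, G.graph.degree v ≤ k) {r : V} (hr : G.graph.degree r < k) :
    G.IsColourable k := by
  have hprop : G.IsProperOn k (fun _ => 0) (∅ : Finset V) := ⟨by simp, by simp⟩
  obtain ⟨ψ, -, hψ⟩ := hprop.exists_extension hdeg (fun v => G.graph.dist v r)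
    (R := Finset.univ) (by simp) (by
      intro v _
      by_cases hv : v = r
      · exact .inl (hv ▸ hr)
      · obtain ⟨w, hw, hlt⟩ := exists_adj_dist_lt hconn hv
        exact .inr (.inr (.inr ⟨w, Finset.mem_univ _, hw, hlt⟩)))
  rw [Finset.empty_union, Finset.coe_univ] at hψ
  exact hψ.isColourable

/-- The complement of a set that contains `r` is colourable. -/
theorem exists_isProperOn_compl {k : ℕ} (hconn : G.graph.Connected)
    (hdeg : ∀ v, G.graph.degree v ≤ k) {C : Finset V} {r : V} (hr : r ∈ C) :
    ∃ φ, G.IsProperOn k φ (Cᶜ : Finset V) := by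
  have hprop : G.IsProperOn k (fun _ => 0) (∅ : Finset V) := ⟨by simp, by simp⟩
  obtain ⟨ψ, -, hψ⟩ := hprop.exists_extension hdeg (fun v => G.graph.dist v r)
    (R := Cᶜ) (by simp) (by
      intro v hv
      obtain ⟨w, hw, hlt⟩ := exists_adj_dist_lt hconn
        (ne_of_mem_of_not_mem hr (Finset.mem_compl.1 hv)).symm
      -- The neighbour nearer to `r` either lies in `C`, and stays uncoloured, or is coloured later.
      by_cases hwC : w ∈ C
      · exact .inr (.inl ⟨w, hw, by simp, by simpa using hwC⟩)
      · exact .inr (.inr (.inr ⟨w, by simpa using hwC, hw, hlt⟩)))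
  rw [Finset.empty_union] at hψ
  exact ⟨ψ, hψ⟩

theorem isColourable_of_eq_top {k : ℕ} (hk : 2 ≤ k) (hdeg : ∀ v, G.graph.degree v ≤ k)
    (htop : G.graph = ⊤) (hbal : ¬ G.IsBalanced) : G.IsColourable k := by
  have hadj : ∀ a b : V, G.graph.Adj a b ↔ a ≠ b := fun a b => by rw [htop]; rfl
  obtain ⟨u⟩ : Nonempty V := by
    by_contra h
    exact hbal fun v => absurd ⟨v⟩ h
  -- An edge `xy` on which this candidate potential fails spans an unbalanced triangle with `u`. The
  -- default value `pairSign u u = 1` excludes `u` as an end of it.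
  have hpot : ¬ G.IsPotential (G.pairSign u) := fun h => hbal h.isBalanced
  simp only [IsPotential, not_forall] at hpot
  obtain ⟨x, y, hxy, hne⟩ := hpot
  have huu : G.pairSign u u = 1 := by simp [pairSign]
  have hux : u ≠ x := by
    rintro rfl
    simp [huu] at hne
  have huy : u ≠ y := by
    rintro rfl
    rw [huu, mul_one, pairSign_comm] at hne
    exact hne rfl
  refine isColourable_of_pair hk hdeg hxy.ne ((hadj _ _).2 hux) ((hadj _ _).2 huy)
    (fun _ he => hne ?_) (fun v => if v = u then 0 else 1) fun v hvx hvy hvu =>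
      ⟨u, hux, huy, (hadj _ _).2 hvu, by simp [hvu]⟩
  rw [he, mul_assoc, Int.units_mul_self, mul_one]

end SignedGraph

/-! ### Maximal paths and the circuits they close -/

namespace SignedGraph

/-- The vertices `p 0, …, p n` are distinct and consecutive ones are adjacent. -/
def IsPathSeq {V : Type*} (Γ : SimpleGraph V) (p : ℕ → V) (n : ℕ) : Prop :=
  Set.InjOn p (Set.Iic n) ∧ ∀ t < n, Γ.Adj (p t) (p (t + 1))

/-- Ranks, colours and potentials on the path can thus be given by formulas in the index. -/
theorem exists_comp_eq {V α : Type*} [Nonempty α] {p : ℕ → V} {n : ℕ}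
    (hp : Set.InjOn p (Set.Iic n)) (g : ℕ → α) : ∃ f : V → α, ∀ t ≤ n, f (p t) = g t :=
  ⟨fun v => g (Function.invFunOn p (Set.Iic n) v), fun t ht => by
    beta_reduce
    rw [hp.leftInvOn_invFunOn (Set.mem_Iic.2 ht)]⟩

/-- A walk from `a` to a non-neighbour must leave the closed neighbourhood of `a`; the edge by which
it leaves gives the other two vertices. -/
theorem exists_adj_adj_not_adj {V : Type*} {Γ : SimpleGraph V} (hconn : Γ.Connected)
    (htop : Γ ≠ ⊤) : ∃ x y z, Γ.Adj x y ∧ Γ.Adj y z ∧ x ≠ z ∧ ¬ Γ.Adj x z := by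
  have : ∃ a b, a ≠ b ∧ ¬ Γ.Adj a b := by
    by_contra! h
    exact htop (by ext a b; exact ⟨fun hab => hab.ne, h a b⟩)
  obtain ⟨a, b, hab, hnadj⟩ := this
  obtain ⟨q⟩ := hconn.preconnected a b
  obtain ⟨d, -, h1, h2⟩ := q.exists_boundary_dart {v | v = a ∨ Γ.Adj a v} (.inl rfl)
    (by simp [hab.symm, hnadj])
  simp only [Set.mem_ofPred_eq, not_or] at h1 h2
  obtain h1 | h1 := h1
  · exact absurd (h1 ▸ d.adj) h2.2
  · exact ⟨a, d.fst, d.snd, h1, d.adj, fun h => h2.1 h.symm, h2.2⟩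

/-- A path on three vertices with non-adjacent ends extends to one whose last vertex has all its
neighbours on the path. -/
theorem exists_maximal_path {V : Type*} [Fintype V] {Γ : SimpleGraph V} (hconn : Γ.Connected)
    (htop : Γ ≠ ⊤) : ∃ p n, 2 ≤ n ∧ IsPathSeq Γ p n ∧ ¬ Γ.Adj (p 0) (p 2) ∧
      ∀ w, Γ.Adj (p n) w → ∃ i < n, p i = w := by
  obtain ⟨x, y, z, hxy, hyz, hxz, hnxz⟩ := exists_adj_adj_not_adj hconn htop
  set P : ℕ → Prop := fun n => ∃ p, 2 ≤ n ∧ IsPathSeq Γ p n ∧ ¬ Γ.Adj (p 0) (p 2) with hP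
  have h2 : P 2 := by
    refine ⟨fun t => if t = 0 then x else if t = 1 then y else z, le_rfl, ⟨?_, ?_⟩, by simpa⟩
    · intro a ha b hb
      simp only [Set.mem_Iic] at ha hb
      have := hxy.ne
      have := hyz.ne
      interval_cases a <;> interval_cases b <;> simp_all [eq_comm]
    · intro t ht
      interval_cases t <;> simpa
  have hbound : ∀ n, P n → n ≤ Fintype.card V := by
    rintro n ⟨p, -, ⟨hinj, -⟩, -⟩
    have := Finset.card_le_card_of_injOn (s := Finset.Iic n) (t := Finset.univ) p (by simp)
      (by simpa using hinj)
    rw [Nat.card_Iic, Finset.card_univ] at this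
    omega
  classical
  have hmax := Nat.findGreatest_spec (P := P) (hbound 2 h2) h2
  obtain ⟨p, hn, ⟨hinj, hadj⟩, hn02⟩ := hmax
  set n := Nat.findGreatest P (Fintype.card V) with hndef
  refine ⟨p, n, hn, ⟨hinj, hadj⟩, hn02, fun w hw => ?_⟩
  by_contra! hno
  have hne : ∀ i ≤ n, p i ≠ w := fun i hi => by
    obtain h | rfl := hi.lt_or_eq
    · exact hno i h
    · exact hw.ne
  have hsucc : P (n + 1) := by
    refine ⟨Function.update p (n + 1) w, by omega, ⟨?_, ?_⟩, ?_⟩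
    · intro a ha b hb hab
      simp only [Set.mem_Iic] at ha hb
      simp only [Function.update_apply] at hab
      split_ifs at hab with h1 h2 h2
      · omega
      · exact absurd hab.symm (hne b (by omega))
      · exact absurd hab (hne a (by omega))
      · exact hinj (Set.mem_Iic.2 (by omega)) (Set.mem_Iic.2 (by omega)) hab
    · intro t ht
      rw [Function.update_of_ne (by omega)]
      obtain h | rfl := (Nat.lt_succ_iff.1 ht).lt_or_eq
      · rw [Function.update_of_ne (by omega)]
        exact hadj t h
      · rw [Function.update_self]
        exact hw
    · rwa [Function.update_of_ne (by omega), Function.update_of_ne (by omega)]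
  have := Nat.le_findGreatest (hbound _ hsucc) hsucc
  omega

variable {V : Type*} {G : SignedGraph V} [DecidableRel G.graph.Adj] [Fintype V] [DecidableEq V]

/-- The colouring is possible if the path ends in a circuit, closed by its last vertex, that does
not contain all vertices. -/
theorem isColourable_of_circuit_ne_univ {k : ℕ} (hconn : G.graph.Connected)
    (hdeg : ∀ v, G.graph.degree v ≤ k) {p : ℕ → V} {j n : ℕ} (hp : IsPathSeq G.graph p n)
    (hj : j < n) (hclose : G.graph.Adj (p n) (p j))
    (hend : ∀ w, G.graph.Adj (p n) w → ∃ i, j ≤ i ∧ i ≤ n ∧ p i = w)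
    {z : V} (hz : ∀ i, j ≤ i → i ≤ n → p i ≠ z) : G.IsColourable k := by
  obtain ⟨hinj, hadj⟩ := hp
  set C := (Finset.Icc j n).image p with hC
  have hmem : ∀ i, j ≤ i → i ≤ n → p i ∈ C := fun i h1 h2 =>
    Finset.mem_image_of_mem p (Finset.mem_Icc.2 ⟨h1, h2⟩)
  have hmem' : ∀ v ∈ C, ∃ i, j ≤ i ∧ i ≤ n ∧ p i = v := fun v hv => by
    simpa [hC, and_assoc] using hv
  have hinj' : ∀ a b, a ≤ n → b ≤ n → p a = p b → a = b := fun a b ha hb h =>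
    hinj (Set.mem_Iic.2 ha) (Set.mem_Iic.2 hb) h
  set out : ℕ → Prop := fun i => ∃ u, G.graph.Adj (p i) u ∧ u ∉ C with hout
  have hlast : ¬ out n := by
    rintro ⟨u, hu, huC⟩
    obtain ⟨i, h1, h2, rfl⟩ := hend u hu
    exact huC (hmem i h1 h2)
  have hsome : ∃ i, j ≤ i ∧ i ≤ n ∧ out i := by
    obtain ⟨q⟩ := hconn.preconnected (p j) z
    obtain ⟨d, -, h1, h2⟩ := q.exists_boundary_dart (C : Set V) (hmem j le_rfl hj.le)
      (fun h => by
        obtain ⟨i, h1, h2, h3⟩ := hmem' z h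
        exact hz i h1 h2 h3)
    obtain ⟨i, hji, hin, hi⟩ := hmem' _ h1
    exact ⟨i, hji, hin, d.snd, hi ▸ d.adj, h2⟩
  -- Otherwise having an outside neighbour would propagate along the path up to `p n`, which has
  -- none.
  have hstep : ∃ i, j ≤ i ∧ i < n ∧ out i ∧ ¬ out (i + 1) := by
    by_contra! hno
    obtain ⟨i, hji, hin, hi⟩ := hsome
    refine hlast (Nat.le_induction (P := fun m _ => m ≤ n → out m) (fun _ => hi)
      (fun m him ih hm => hno m (by omega) (by omega) (ih (by omega))) n hin le_rfl)
  obtain ⟨i, hji, hin, ⟨u, hu, huC⟩, hnot⟩ := hstep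
  have hnot' : ∀ v ∈ Cᶜ, ¬ G.graph.Adj (p (i + 1)) v := fun v hv h =>
    hnot ⟨v, h, Finset.mem_compl.1 hv⟩
  obtain ⟨φ, hφ⟩ := exists_isProperOn_compl hconn hdeg (hmem j le_rfl hj.le)
  have hwC := hmem (i + 1) (by omega) (by omega)
  -- The colour that makes `p (i + 1)` forbid at `p i` exactly what `u` forbids there; `p (i + 1)`
  -- has no coloured neighbour yet.
  set φ' := Function.update φ (p (i + 1))
    (G.pairSign (p i) (p (i + 1)) * (G.pairSign (p i) u * φ u)) with hφ'
  have hagree : ∀ v ∈ Cᶜ, φ' v = φ v := fun v hv => by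
    rw [hφ', Function.update_of_ne]
    rintro rfl
    exact Finset.mem_compl.1 hv hwC
  have huC' : u ∈ Cᶜ := Finset.mem_compl.2 huC
  have hprop : G.IsProperOn k φ' (insert (p (i + 1)) Cᶜ : Finset V) := by
    rw [Finset.coe_insert]
    refine (hφ.congr hagree).insert_of_ne ?_ fun v hv h => absurd h (hnot' v hv)
    rw [hφ', Function.update_self]
    exact unit_mul_mem_colourSet _ (unit_mul_mem_colourSet _ (hφ.2 u huC'))
  -- Colouring goes round the circuit in the order `p (i + 2), …, p n, p j, …, p i`, each vertex
  -- before the last being followed by an uncoloured neighbour.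
  obtain ⟨f, hf⟩ := exists_comp_eq hinj (fun a => if a ≤ i then i - a else n - a + 1 + (i - j))
  obtain ⟨ψ, -, hψ⟩ := hprop.exists_extension hdeg f (R := C.erase (p (i + 1)))
    (Finset.disjoint_insert_left.2 ⟨by simp,
      disjoint_compl_left.mono_right (Finset.erase_subset _ _)⟩) (by
      intro v hv
      obtain ⟨hvne, hvC⟩ := Finset.mem_erase.1 hv
      obtain ⟨a, hja, han, rfl⟩ := hmem' v hvC
      have ha : a ≠ i + 1 := fun h => hvne (by rw [h])
      have herase : ∀ b, j ≤ b → b ≤ n → b ≠ i + 1 → p b ∈ C.erase (p (i + 1)) :=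
        fun b h1 h2 h3 => Finset.mem_erase.2
          ⟨fun h => h3 (hinj' _ _ h2 (by omega) h), hmem b h1 h2⟩
      by_cases hai : a = i
      · subst hai
        refine .inr (.inr (.inl ⟨u, Finset.mem_insert_of_mem huC', p (a + 1),
          Finset.mem_insert_self _ _, ?_, hu, hadj a hin, ?_⟩))
        · rintro rfl
          exact huC hwC
        · rw [hagree u huC', hφ', Function.update_self, unit_mul_unit_mul]
      · refine .inr (.inr (.inr ?_))
        by_cases haN : a = n
        · refine ⟨p j, herase j le_rfl hj.le (by omega), haN ▸ hclose, ?_⟩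
          rw [hf _ han, hf _ hj.le, if_pos hji, if_neg (by omega)]
          omega
        · refine ⟨p (a + 1), herase _ (by omega) (by omega) (by omega), hadj a (by omega), ?_⟩
          rw [hf _ han, hf _ (by omega)]
          split_ifs <;> omega)
  have huniv : insert (p (i + 1)) Cᶜ ∪ C.erase (p (i + 1)) = Finset.univ := by
    rw [Finset.insert_union, ← Finset.union_insert, Finset.insert_erase hwC, Finset.union_comm,
      Finset.union_compl]
  rw [huniv, Finset.coe_univ] at hψ
  exact hψ.isColourable

/-- A third neighbour `p j` of `p 1` has `j ≥ 3`. After `p 0` and `p 2` are coloured, the rest of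
the path is still connected and leads through `p j` to `p 1`, which comes last. -/
theorem isColourable_of_hamiltonian_path {k : ℕ} (hk : 2 ≤ k)
    (hdeg : ∀ v, G.graph.degree v ≤ k) {p : ℕ → V} {n : ℕ} (hp : IsPathSeq G.graph p n)
    (hn : 2 ≤ n) (hn02 : ¬ G.graph.Adj (p 0) (p 2)) (hall : ∀ v, ∃ i ≤ n, p i = v)
    (h3 : 3 ≤ G.graph.degree (p 1)) : G.IsColourable k := by
  obtain ⟨hinj, hadj⟩ := hp
  have hinj' : ∀ a b, a ≤ n → b ≤ n → p a = p b → a = b := fun a b ha hb h =>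
    hinj (Set.mem_Iic.2 ha) (Set.mem_Iic.2 hb) h
  obtain ⟨w, hw, hwne⟩ : ∃ w ∈ G.graph.neighborFinset (p 1), w ∉ ({p 0, p 2} : Finset V) :=
    Finset.exists_mem_notMem_of_card_lt_card (lt_of_le_of_lt Finset.card_le_two h3)
  obtain ⟨j, hj, rfl⟩ := hall w
  rw [SimpleGraph.mem_neighborFinset] at hw
  simp only [Finset.mem_insert, Finset.mem_singleton, not_or] at hwne
  have hj3 : 3 ≤ j := by
    by_contra! h
    interval_cases j
    · exact hwne.1 rfl
    · exact hw.ne rfl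
    · exact hwne.2 rfl
  -- With truncated subtraction this is `|a - j| + 1`, so `p j` comes just before `p 1`.
  obtain ⟨f, hf⟩ := exists_comp_eq hinj (fun a => if a = 1 then 0 else (a - j) + (j - a) + 1)
  have hne : ∀ a b, a ≤ n → b ≤ n → a ≠ b → p a ≠ p b := fun a b ha hb hab h =>
    hab (hinj' a b ha hb h)
  refine isColourable_of_pair hk hdeg (hne 0 2 (by omega) hn (by omega)) (hadj 0 (by omega)).symm
    (hadj 1 (by omega)) (fun h => absurd h hn02) f fun v hv0 hv2 hv1 => ?_
  obtain ⟨a, ha, rfl⟩ := hall v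
  have ha3 : 3 ≤ a := by
    by_contra! h
    interval_cases a
    · exact hv0 rfl
    · exact hv1 rfl
    · exact hv2 rfl
  obtain hlt | rfl | hlt := lt_trichotomy a j
  · refine ⟨p (a + 1), hne _ _ (by omega) (by omega) (by omega),
      hne _ _ (by omega) (by omega) (by omega), hadj a (by omega), ?_⟩
    rw [hf _ ha, hf _ (by omega), if_neg (by omega), if_neg (by omega)]
    omega
  · refine ⟨p 1, hne _ _ (by omega) (by omega) (by omega),
      hne _ _ (by omega) (by omega) (by omega), hw.symm, ?_⟩
    rw [hf _ ha, hf _ (by omega), if_pos rfl, if_neg (by omega)]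
    omega
  · obtain ⟨b, rfl⟩ : ∃ b, a = b + 1 := ⟨a - 1, by omega⟩
    refine ⟨p b, hne _ _ (by omega) (by omega) (by omega),
      hne _ _ (by omega) (by omega) (by omega), (hadj b (by omega)).symm, ?_⟩
    rw [hf _ ha, hf _ (by omega), if_neg (by omega), if_neg (by omega)]
    omega

end SignedGraph

/-! ### Circuits and the case of degree two -/

namespace SignedGraph

section Circuit

variable {V : Type*} {Γ : SimpleGraph V} {p : ℕ → V} {n : ℕ}

theorem IsPathSeq.adj_add_one (hp : IsPathSeq Γ p n) (hclose : Γ.Adj (p n) (p 0))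
    (a : Fin (n + 1)) : Γ.Adj (p a) (p ↑(a + 1)) := by
  by_cases h : a = Fin.last n
  · subst h
    simpa using hclose
  · have hlt := Fin.lt_last_iff_ne_last.2 h
    rw [Fin.val_add_one_of_lt hlt]
    exact hp.2 a hlt

variable [Fintype V] [DecidableRel Γ.Adj]

/-- The two cyclic neighbours of `p a` already exhaust its degree; `2 ≤ n` makes them distinct. -/
theorem IsPathSeq.adj_iff_of_degree (hp : IsPathSeq Γ p n) (hn : 2 ≤ n)
    (hclose : Γ.Adj (p n) (p 0)) (hdeg : ∀ v, Γ.degree v = 2) (a b : Fin (n + 1)) :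
    Γ.Adj (p a) (p b) ↔ b = a + 1 ∨ a = b + 1 := by
  classical
  have hadj := hp.adj_add_one hclose
  constructor
  · intro hab
    have hinj : ∀ x y : Fin (n + 1), p x = p y → x = y := fun x y h =>
      Fin.ext (hp.1 (Set.mem_Iic.2 (by omega)) (Set.mem_Iic.2 (by omega)) h)
    have hne : a + 1 ≠ a - 1 := by
      intro h
      have h2 : (1 : Fin (n + 1)) + 1 = 0 := by
        have : a + (1 + 1) = a := by rw [← add_assoc, h, sub_add_cancel]
        simpa using this
      have := congrArg Fin.val h2
      rw [Fin.val_add, Fin.val_one', Nat.mod_eq_of_lt (by omega : 1 < n + 1),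
        Nat.mod_eq_of_lt (by omega)] at this
      simp at this
    have hsub : ({p ↑(a + 1), p ↑(a - 1)} : Finset V) ⊆ Γ.neighborFinset (p a) := by
      intro v hv
      rw [SimpleGraph.mem_neighborFinset]
      simp only [Finset.mem_insert, Finset.mem_singleton] at hv
      obtain rfl | rfl := hv
      · exact hadj a
      · have := hadj (a - 1)
        rw [sub_add_cancel] at this
        exact this.symm
    have heq := Finset.eq_of_subset_of_card_le hsub (by
      rw [Finset.card_pair fun h => hne (hinj _ _ h)]
      exact (hdeg (p a)).le)
    have hb : p b ∈ ({p ↑(a + 1), p ↑(a - 1)} : Finset V) := by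
      rw [heq, SimpleGraph.mem_neighborFinset]
      exact hab
    simp only [Finset.mem_insert, Finset.mem_singleton] at hb
    obtain hb | hb := hb
    · exact .inl (hinj _ _ hb)
    · exact .inr (by rw [hinj _ _ hb, sub_add_cancel])
  · rintro (rfl | rfl)
    · exact hadj a
    · exact (hadj b).symm

/-- A symmetric relation that holds along the circuit holds for all edges. -/
theorem IsPathSeq.forall_adj (hp : IsPathSeq Γ p n) (hn : 2 ≤ n)
    (hclose : Γ.Adj (p n) (p 0)) (hdeg : ∀ v, Γ.degree v = 2) (hall : ∀ v, ∃ i ≤ n, p i = v)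
    {r : V → V → Prop} (hsymm : ∀ u v, r u v → r v u) (hr : ∀ t < n, r (p t) (p (t + 1)))
    (hr0 : r (p n) (p 0)) (u v : V) (huv : Γ.Adj u v) : r u v := by
  have key : ∀ a : Fin (n + 1), r (p a) (p ↑(a + 1)) := by
    intro a
    by_cases h : a = Fin.last n
    · subst h
      simpa using hr0
    · have hlt := Fin.lt_last_iff_ne_last.2 h
      rw [Fin.val_add_one_of_lt hlt]
      exact hr a hlt
  obtain ⟨a, ha, rfl⟩ := hall u
  obtain ⟨b, hb, rfl⟩ := hall v
  have := (hp.adj_iff_of_degree hn hclose hdeg ⟨a, by omega⟩ ⟨b, by omega⟩).1 huv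
  obtain h | h := this
  · have := key ⟨a, by omega⟩
    rwa [← h] at this
  · have := key ⟨b, by omega⟩
    rw [← h] at this
    exact hsymm _ _ this

theorem IsPathSeq.nonempty_iso_cycleGraph (hp : IsPathSeq Γ p n) (hn : 2 ≤ n)
    (hclose : Γ.Adj (p n) (p 0)) (hdeg : ∀ v, Γ.degree v = 2) (hall : ∀ v, ∃ i ≤ n, p i = v) :
    Nonempty (Γ ≃g SimpleGraph.cycleGraph (n + 1)) := by
  obtain ⟨m, rfl⟩ : ∃ m, n = m + 1 := ⟨n - 1, by omega⟩
  have hbij : Function.Bijective (fun a : Fin (m + 1 + 1) => p a) := by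
    refine ⟨fun x y h => Fin.ext (hp.1 (Set.mem_Iic.2 (by omega)) (Set.mem_Iic.2 (by omega)) h),
      fun v => ?_⟩
    obtain ⟨i, hi, rfl⟩ := hall v
    exact ⟨⟨i, by omega⟩, rfl⟩
  refine ⟨SimpleGraph.Iso.symm ⟨Equiv.ofBijective _ hbij, fun {a b} => ?_⟩⟩
  rw [Equiv.ofBijective_apply, Equiv.ofBijective_apply, hp.adj_iff_of_degree hn hclose hdeg,
    SimpleGraph.cycleGraph_adj, sub_eq_iff_eq_add', sub_eq_iff_eq_add',
    or_comm]

end Circuit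

variable {V : Type*} {G : SignedGraph V} [DecidableRel G.graph.Adj] {p : ℕ → V} {n : ℕ}

/-- The walk runs backwards, so that the closing edge from `p 0` to `p n` can be put in front; the
edge list shows that this edge is new. -/
theorem IsPathSeq.exists_walk (hp : IsPathSeq G.graph p n) {t : ℕ} (ht : t ≤ n) :
    ∃ q : G.graph.Walk (p t) (p 0), q.IsPath ∧ (∀ v ∈ q.support, ∃ s ≤ t, p s = v) ∧
      (∀ e ∈ q.edges, ∃ s < t, e = s(p s, p (s + 1))) ∧
      G.walkSign q = ∏ s ∈ Finset.range t, G.pairSign (p s) (p (s + 1)) := by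
  induction t with
  | zero => exact ⟨.nil, by simp, by simp, by simp, by simp [walkSign]⟩
  | succ t ih =>
    obtain ⟨q, hq, hs, he, hsign⟩ := ih (by omega)
    refine ⟨.cons (hp.2 t ht).symm q, ?_, ?_, ?_, ?_⟩
    · rw [SimpleGraph.Walk.cons_isPath_iff]
      refine ⟨hq, fun h => ?_⟩
      obtain ⟨s, hst, h⟩ := hs _ h
      have := hp.1 (Set.mem_Iic.2 (by omega)) (Set.mem_Iic.2 (by omega)) h
      omega
    · intro v hv
      rw [SimpleGraph.Walk.support_cons, List.mem_cons] at hv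
      obtain rfl | hv := hv
      · exact ⟨_, le_rfl, rfl⟩
      · obtain ⟨s, hst, rfl⟩ := hs v hv
        exact ⟨s, by omega, rfl⟩
    · intro e h
      rw [SimpleGraph.Walk.edges_cons, List.mem_cons] at h
      obtain rfl | h := h
      · exact ⟨t, by omega, Sym2.eq_swap⟩
      · obtain ⟨s, hst, rfl⟩ := he e h
        exact ⟨s, by omega, rfl⟩
    · rw [walkSign_cons, hsign, Finset.prod_range_succ, mul_comm, pairSign_comm]

theorem IsPathSeq.pairSign_eq_prod (hp : IsPathSeq G.graph p n) (hn : 2 ≤ n)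
    (hclose : G.graph.Adj (p n) (p 0)) (hbal : G.IsBalanced) :
    G.pairSign (p n) (p 0) = ∏ s ∈ Finset.range n, G.pairSign (p s) (p (s + 1)) := by
  obtain ⟨q, hq, -, he, hsign⟩ := hp.exists_walk le_rfl
  have hinj : ∀ a b, a ≤ n → b ≤ n → p a = p b → a = b := fun a b ha hb h =>
    hp.1 (Set.mem_Iic.2 ha) (Set.mem_Iic.2 hb) h
  have hcyc : (SimpleGraph.Walk.cons hclose.symm q).IsCycle := by
    rw [SimpleGraph.Walk.cons_isCycle_iff]
    refine ⟨hq, fun h => ?_⟩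
    obtain ⟨s, hs, h⟩ := he _ h
    rw [Sym2.eq_iff] at h
    obtain ⟨h1, h2⟩ | ⟨h1, h2⟩ := h
    · have := hinj _ _ (by omega) (by omega) h1
      have := hinj _ _ (by omega) (by omega) h2
      omega
    · have := hinj _ _ (by omega) (by omega) h1
      omega
  have := hbal _ _ hcyc
  rw [walkSign_cons, hsign, pairSign_comm] at this
  rw [← mul_right_inj (G.pairSign (p n) (p 0)), this, Int.units_mul_self]

variable [Fintype V]

/-- With colours `±1`, proper means `φ u = -σ(uv) φ v` on every edge. Along the path this determines
`φ` up to a global sign as `(-1) ^ t * P t`, so only the closing edge imposes a condition. It holds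
for a balanced circuit of even length and for an unbalanced one of odd length. -/
theorem isColourable_two_of_circuit (hp : IsPathSeq G.graph p n) (hn : 2 ≤ n)
    (hclose : G.graph.Adj (p n) (p 0)) (hdeg : ∀ v, G.graph.degree v = 2)
    (hall : ∀ v, ∃ i ≤ n, p i = v) (hodd : ¬ (G.IsOddCircuit ∧ G.IsBalanced))
    (heven : ¬ (G.IsEvenCircuit ∧ ¬ G.IsBalanced)) : G.IsColourable 2 := by
  set P : ℕ → ℤˣ := fun t => ∏ s ∈ Finset.range t, G.pairSign (p s) (p (s + 1)) with hP
  have hP0 : P 0 = 1 := by simp [hP]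
  have hPs : ∀ t, G.pairSign (p t) (p (t + 1)) = P t * P (t + 1) := fun t => by
    simp only [hP]
    rw [Finset.prod_range_succ, ← mul_assoc, Int.units_mul_self, one_mul]
  have hcirc : G.IsCircuit (n + 1) :=
    ⟨by omega, hp.nonempty_iso_cycleGraph hn hclose hdeg hall⟩
  have hcolour : G.pairSign (p n) (p 0) = (-1) ^ (n + 1) * P n → G.IsColourable 2 := by
    intro hsign
    obtain ⟨φ, hφ⟩ := exists_comp_eq hp.1 (fun t => (-1) ^ t * P t)
    have key := hp.forall_adj hn hclose hdeg hall
      (r := fun u v => φ u = -(G.pairSign u v * φ v)) (fun u v h => by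
        rw [h, G.pairSign_comm v u, mul_neg, neg_neg, ← mul_assoc, Int.units_mul_self, one_mul])
      (fun t ht => by
        rw [hφ _ ht.le, hφ _ ht, hPs t, pow_succ]
        calc (-1) ^ t * P t = (-1) ^ t * P t * (P (t + 1) * P (t + 1)) := by
              rw [Int.units_mul_self, mul_one]
          _ = _ := by
              rw [mul_neg_one, neg_mul, mul_neg, neg_neg]
              ac_rfl)
      (by
        rw [hφ _ le_rfl, hφ _ (Nat.zero_le n), hsign, hP0, pow_succ]
        simp)
    refine IsProperOn.isColourable (φ := fun v => φ v)
      ⟨fun u _ v _ huv he => ?_, fun v _ => unit_mem_colourSet le_rfl _⟩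
    have h := key u v huv
    rw [← Units.val_mul, Units.val_inj] at he
    exact units_ne_neg_self (φ u) (h.trans (congrArg _ he.symm))
  obtain hpar | hpar := Nat.even_or_odd (n + 1)
  · have hbal : G.IsBalanced := by
      by_contra hbal
      exact heven ⟨⟨_, hpar, hcirc⟩, hbal⟩
    apply hcolour
    rw [hpar.neg_one_pow, one_mul]
    exact hp.pairSign_eq_prod hn hclose hbal
  · apply hcolour
    rw [hpar.neg_one_pow, neg_one_mul]
    have hcases : G.pairSign (p n) (p 0) = P n ∨ G.pairSign (p n) (p 0) = -P n := by
      obtain h | h := Int.units_eq_one_or (G.pairSign (p n) (p 0)) <;>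
        obtain h' | h' := Int.units_eq_one_or (P n) <;> simp [h, h']
    obtain h | h := hcases
    -- If the closing edge agreed with `P`, then `P` would be a potential and the odd circuit would
    -- be balanced.
    · refine absurd ⟨⟨_, hpar, hcirc⟩, ?_⟩ hodd
      obtain ⟨θ, hθ⟩ := exists_comp_eq hp.1 P
      refine IsPotential.isBalanced (θ := θ) (hp.forall_adj hn hclose hdeg hall
        (r := fun u v => G.pairSign u v = θ u * θ v) (fun u v h => by
          rw [pairSign_comm, h, mul_comm]) (fun t ht => ?_) ?_)
      · rw [hθ _ ht.le, hθ _ ht, hPs]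
      · rw [hθ _ le_rfl, hθ _ (Nat.zero_le n), hP0, mul_one, h]
    · exact h

/-! ### Case distinction and conclusion -/

theorem isColourable_maxDegree (hconn : G.graph.Connected)
    (hcomplete : ¬ (G.IsComplete ∧ G.IsBalanced)) (hodd : ¬ (G.IsOddCircuit ∧ G.IsBalanced))
    (heven : ¬ (G.IsEvenCircuit ∧ ¬ G.IsBalanced)) :
    1 ≤ G.graph.maxDegree ∧ G.IsColourable G.graph.maxDegree := by
  classical
  have hdeg : ∀ v, G.graph.degree v ≤ G.graph.maxDegree := G.graph.degree_le_maxDegree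
  suffices h : 2 ≤ G.graph.maxDegree ∧ G.IsColourable G.graph.maxDegree from ⟨by omega, h.2⟩
  by_cases htop : G.graph = ⊤
  · have hbal : ¬ G.IsBalanced := fun h => hcomplete ⟨htop, h⟩
    -- An unbalanced graph contains a circuit, hence at least three vertices.
    have hk : 2 ≤ G.graph.maxDegree := by
      simp only [IsBalanced, not_forall] at hbal
      obtain ⟨v, c, hc, -⟩ := hbal
      have hcard : 3 ≤ Fintype.card V := by
        have h1 := hc.three_le_length
        have h2 := hc.support_nodup.length_le_card
        simp at h2
        omega
      have := hdeg v
      have h3 : G.graph.degree v = Fintype.card V - 1 := by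
        have h4 := SimpleGraph.complete_graph_degree v
        convert h4
      omega
    exact ⟨hk, isColourable_of_eq_top hk hdeg htop hbal⟩
  obtain ⟨p, n, hn, hp, hn02, hend⟩ := exists_maximal_path hconn htop
  have hinj : ∀ a b, a ≤ n → b ≤ n → p a = p b → a = b := fun a b ha hb h =>
    hp.1 (Set.mem_Iic.2 ha) (Set.mem_Iic.2 hb) h
  have hk : 2 ≤ G.graph.maxDegree := by
    refine le_trans ?_ (hdeg (p 1))
    have hsub : ({p 0, p 2} : Finset V) ⊆ G.graph.neighborFinset (p 1) := by
      intro v hv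
      rw [SimpleGraph.mem_neighborFinset]
      simp only [Finset.mem_insert, Finset.mem_singleton] at hv
      obtain rfl | rfl := hv
      · exact (hp.2 0 (by omega)).symm
      · exact hp.2 1 (by omega)
    have := Finset.card_le_card hsub
    rwa [Finset.card_pair fun h => absurd (hinj _ _ (by omega) hn h) (by omega)] at this
  refine ⟨hk, ?_⟩
  by_cases hreg : ∃ r, G.graph.degree r < G.graph.maxDegree
  · obtain ⟨r, hr⟩ := hreg
    exact isColourable_of_degree_lt hconn hdeg hr
  push Not at hreg
  have hex : ∃ j, j < n ∧ G.graph.Adj (p n) (p j) := by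
    obtain ⟨m, rfl⟩ : ∃ m, n = m + 1 := ⟨n - 1, by omega⟩
    exact ⟨m, by omega, (hp.2 m (by omega)).symm⟩
  -- Taking the earliest neighbour of `p n` puts all its neighbours on the circuit `p j, …, p n`.
  obtain ⟨hj, hclose⟩ := Nat.find_spec hex
  have hmin : ∀ i < n, G.graph.Adj (p n) (p i) → Nat.find hex ≤ i := fun i hi h =>
    Nat.find_min' hex ⟨hi, h⟩
  set j := Nat.find hex
  by_cases hspan : ∀ z, ∃ i, j ≤ i ∧ i ≤ n ∧ p i = z
  · have hall : ∀ v, ∃ i ≤ n, p i = v := fun v => by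
      obtain ⟨i, -, h⟩ := hspan v
      exact ⟨i, h⟩
    by_cases h3 : 3 ≤ G.graph.maxDegree
    · exact isColourable_of_hamiltonian_path hk hdeg hp hn hn02 hall (h3.trans (hreg _))
    · have h2 : G.graph.maxDegree = 2 := by omega
      rw [h2] at hreg hdeg ⊢
      -- A spanning circuit contains `p 0`, so it starts there.
      have hj0 : j = 0 := by
        obtain ⟨i, hji, hin, h⟩ := hspan (p 0)
        have := hinj _ _ hin (by omega) h
        omega
      rw [hj0] at hclose
      exact isColourable_two_of_circuit hp hn hclose (fun v => (hdeg v).antisymm (hreg v)) hall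
        hodd heven
  · push Not at hspan
    obtain ⟨z, hz⟩ := hspan
    refine isColourable_of_circuit_ne_univ hconn hdeg hp hj hclose (fun w hw => ?_) hz
    obtain ⟨i, hi, rfl⟩ := hend w hw
    exact ⟨i, hmin i hi hw, hi.le, rfl⟩

end SignedGraph

theorem mainTheorem1 {V : Type*} [Fintype V] (G : SignedGraph V) [DecidableRel G.graph.Adj]
    (hconn : G.graph.Connected)
    (hcomplete : ¬ (G.IsComplete ∧ G.IsBalanced))
    (hodd : ¬ (G.IsOddCircuit ∧ G.IsBalanced))
    (heven : ¬ (G.IsEvenCircuit ∧ ¬ G.IsBalanced)) :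
    G.chromaticNumber ≤ (G.graph.maxDegree : ℕ∞) :=
  iInf₂_le (f := fun (n : ℕ) (_ : n ∈ {n : ℕ | 1 ≤ n ∧ G.IsColourable n}) => (n : ℕ∞)) _
    (SignedGraph.isColourable_maxDegree hconn hcomplete hodd heven)
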